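/- Let $n\ge 0$ and let $f:\{0,1\}^n\to\{0,1\}$ be a Boolean function. Identify $f$ with the unique multilinear polynomial in $\mathbb{R}[x_1,\dots,x_n]$ that agrees with $f$ on $\{0,1\}^n$, and let $\deg(f)$ be its total degree (with $\deg(f)=0$ if $f$ is constant). Let $R(f)$ be the set of relevant variables, i.e. of those $i$ for which $x_i$ occurs in a monomial of this polynomial with non-zero coefficient, and for $i\in R(f)$ let $\deg_i(f)$ be the largest degree of a monomial containing $x_i$ that occurs with non-zero coefficient. (1) If $\deg(f)=d$, then $f$ has at most $4.416\cdot 2^d$ relevant variables, i.e. $|R(f)|\le 4.416\cdot 2^{d}$. (2) Moreover, $W(f):=\sum_{i\in R(f)}2^{-\deg_i(f)}\le 4.4158$ for every Boolean function $f$ of any number of variables. -/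

import Mathlib

/-- The multilinear real polynomial that represents a Boolean function `f : {0,1}ⁿ → {0,1}`:
the sum, over the inputs `a` with `f a = 1`, of the indicator polynomial
`∏ᵢ (Xᵢ if aᵢ = 1, and 1 - Xᵢ if aᵢ = 0)` of `a`. -/
noncomputable def boolPoly {n : ℕ} (f : (Fin n → Bool) → Bool) : MvPolynomial (Fin n) ℝ :=
  ∑ a : Fin n → Bool, if f a = true then
    ∏ i, (if a i = true then MvPolynomial.X i else 1 - MvPolynomial.X i) else 0

/-- The polynomial agrees with `f` on every input in `{0,1}ⁿ`. -/
theorem eval_boolPoly {n : ℕ} (f : (Fin n → Bool) → Bool) (x : Fin n → Bool) :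
    MvPolynomial.eval (fun i => if x i = true then (1 : ℝ) else 0) (boolPoly f) =
      if f x = true then 1 else 0 := by
  unfold boolPoly
  rw [map_sum, Finset.sum_eq_single x]
  · by_cases hf : f x = true
    · simp only [hf, if_true, map_prod]
      apply Finset.prod_eq_one
      intro i _
      by_cases hx : x i = true <;> simp [hx]
    · simp [hf]
  · intro a _ hax
    by_cases hf : f a = true
    · simp only [hf, if_true, map_prod]
      obtain ⟨i, hi⟩ := Function.ne_iff.mp hax
      apply Finset.prod_eq_zero (Finset.mem_univ i)
      cases ha : a i <;> cases hx : x i <;> simp_all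
    · simp [hf]
  · simp

/-- The polynomial is multilinear: no variable occurs in it with an exponent above `1`. -/
theorem boolPoly_multilinear {n : ℕ} (f : (Fin n → Bool) → Bool) :
    boolPoly f ∈ MvPolynomial.restrictDegree (Fin n) ℝ 1 := by
  unfold boolPoly
  refine Submodule.sum_mem _ fun a _ => ?_
  split_ifs
  · rw [MvPolynomial.mem_restrictDegree]
    intro s hs j
    refine (MvPolynomial.degreeOf_le_iff.mp ?_) s hs
    refine (MvPolynomial.degreeOf_prod_le j _ _).trans ?_
    rw [Finset.sum_eq_single j]
    · split_ifs
      · simp [MvPolynomial.degreeOf_X]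
      · refine (MvPolynomial.degreeOf_sub_le _ _ _).trans ?_
        simp [MvPolynomial.degreeOf_X]
    · intro i _ hij
      split_ifs
      · simp [MvPolynomial.degreeOf_X, hij.symm]
      · refine Nat.le_zero.mp ((MvPolynomial.degreeOf_sub_le _ _ _).trans ?_)
        simp [MvPolynomial.degreeOf_X, hij.symm]
    · simp
  · exact Submodule.zero_mem _

/-- It is the only multilinear polynomial that agrees with `f` on `{0,1}ⁿ`. -/
theorem boolPoly_unique {n : ℕ} (f : (Fin n → Bool) → Bool) (p : MvPolynomial (Fin n) ℝ)
    (hp : p ∈ MvPolynomial.restrictDegree (Fin n) ℝ 1)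
    (hpf : ∀ x : Fin n → Bool,
      MvPolynomial.eval (fun i => if x i = true then (1 : ℝ) else 0) p =
        if f x = true then 1 else 0) :
    p = boolPoly f := by
  rw [← sub_eq_zero]
  apply MvPolynomial.eq_zero_of_eval_zero_at_prod_finset _ (fun _ => ({0, 1} : Finset ℝ))
  · intro i
    have h := Submodule.sub_mem _ hp (boolPoly_multilinear f)
    have h1 : MvPolynomial.degreeOf i (p - boolPoly f) ≤ 1 :=
      MvPolynomial.degreeOf_le_iff.mpr
        fun s hs => (MvPolynomial.mem_restrictDegree _ _ _).mp h s hs i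
    have h2 : ({0, 1} : Finset ℝ).card = 2 := Finset.card_pair zero_ne_one
    omega
  · intro x hx
    have hx' : x = fun i => if (decide (x i = 1)) = true then (1 : ℝ) else 0 := by
      funext i
      have := hx i
      simp only [Finset.mem_insert, Finset.mem_singleton] at this
      rcases this with h | h <;> simp [h]
    rw [map_sub, hx', hpf, eval_boolPoly, sub_self]

/-- The real degree `deg(f)` of a Boolean function (`0` for constant functions). -/
noncomputable def boolDegree {n : ℕ} (f : (Fin n → Bool) → Bool) : ℕ :=
  (boolPoly f).totalDegree

/-- The set `R(f)` of relevant variables: those that occur in a monomial of the multilinear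
polynomial of `f` with non-zero coefficient. -/
noncomputable def relevantVars {n : ℕ} (f : (Fin n → Bool) → Bool) : Finset (Fin n) :=
  (boolPoly f).vars

/-- `deg_i(f)`: the largest degree of a monomial that contains the variable `i` and occurs in the
multilinear polynomial of `f` with non-zero coefficient (only used for relevant `i`). -/
noncomputable def degreeAt {n : ℕ} (f : (Fin n → Bool) → Bool) (i : Fin n) : ℕ :=
  {m ∈ (boolPoly f).support | i ∈ m.support}.sup Finsupp.degree

/-- The measure `W(f) = ∑_{i ∈ R(f)} 2^{-deg_i(f)}`. -/
noncomputable def juntaWeight {n : ℕ} (f : (Fin n → Bool) → Bool) : ℝ :=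
  ∑ i ∈ relevantVars f, ((2 : ℝ) ^ degreeAt f i)⁻¹

/-!
Write a Boolean function through the coefficients `c S` of its multilinear polynomial and call
`weight c = ∑ i, 2 ^ (-deg_i)` its weight. Only the bound `weight c ≤ 4.4158` needs an argument:
since `deg_i ≤ d`, the number of relevant variables is at most `2 ^ d * weight c`.

Random restrictions do not decrease the expected weight of the variables that stay free
(`varWeight_le_average`). In a function of degree `d`, choose a maximal family of `k` disjoint
monomials of degree `d` and fix the `k * d` variables in them at random. These variables contribute
`k * d / 2 ^ d` to the weight. The degree drops, because every monomial of degree `d` is hit, and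
the block sensitivity drops by at least `k`, because at every input each chosen monomial contains a
sensitive block (`card_add_card_le`). Hence `d / 2 ^ d` is the price of one unit of block
sensitivity in degree `d`, and `weight_le_succ` turns this into a recursion for bounds of the form
`weight ≤ a + d / 2 ^ d * bs`.

Besides the bound from the preceding degree, the recursion uses a bound for the weight by the
degree alone. In degrees up to `7` it is `weight ≤ d / 2`: the weight of a variable is at most half
its influence, and Parseval's identity bounds the total influence by the degree
(`weight_le_half_degree`). From degree `8` on, it comes from a bound for the block sensitivity.
Averaging over unions of `t` disjoint sensitive blocks gives a univariate polynomial of degree at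
most `d` that is `1` at `0`, `0` at `1`, and between `0` and `1` at the integers up to the number of
blocks (`exists_block_polynomial`). Its divided differences of order `d + 1` vanish, which is
impossible when there are too many blocks. In degrees `8` to `19` suitable integer nodes,
close to the extremal points of a Chebyshev polynomial, show this by a finite computation
(`blockSensLE_of_nodes`); in all degrees the nodes `0`, `1` and `2 m²` show that `bs ≤ 2 d²`
(`blockSensLE_two_mul_sq`), which is enough for the tail of the recursion.
-/

namespace BooleanJunta

open Finset

section Weights

/-! ### Functions on the cube given by their multilinear coefficients -/

variable {ι : Type}

/-- The value at the input `T` (the set of coordinates that are `1`) of the multilinear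
polynomial with coefficient `c S` at the monomial `∏ i ∈ S, x i`. -/
def zeta (c : Finset ι → ℝ) (T : Finset ι) : ℝ := ∑ S ∈ T.powerset, c S

/-- The coefficients `c` belong to a polynomial of total degree at most `d`. -/
def DegreeLE (d : ℕ) (c : Finset ι → ℝ) : Prop := ∀ S, c S ≠ 0 → #S ≤ d

/-- The polynomial takes only the values `0` and `1` on the cube. -/
def IsBoolean (c : Finset ι → ℝ) : Prop := ∀ T, zeta c T = 0 ∨ zeta c T = 1

variable [DecidableEq ι]

/-- The coefficients of the polynomial obtained by setting the variables in `A` to `1` and those in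
`H \ A` to `0`. It is used only for `A ⊆ H`. -/
def restrictVars (H A : Finset ι) (c : Finset ι → ℝ) (S : Finset ι) : ℝ :=
  if Disjoint S H then ∑ R ∈ A.powerset, c (S ∪ R) else 0

@[simp] lemma restrictVars_empty (c : Finset ι → ℝ) : restrictVars ∅ ∅ c = c := by
  funext S
  simp [restrictVars]

lemma zeta_insert (c : Finset ι → ℝ) {j : ι} {T : Finset ι} (hj : j ∉ T) :
    zeta c (insert j T) = zeta c T + ∑ S ∈ T.powerset, c (insert j S) :=
  sum_powerset_insert hj _

/-- Fixing one more variable to `0`. -/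
lemma restrictVars_insert_zero (j : ι) (H A : Finset ι) (c : Finset ι → ℝ) :
    restrictVars (insert j H) A c = restrictVars {j} ∅ (restrictVars H A c) := by
  funext S
  by_cases h : j ∈ S <;> by_cases h' : Disjoint S H <;>
    simp [restrictVars, h, h']

/-- Fixing one more variable to `1`. -/
lemma restrictVars_insert_one {j : ι} {H A : Finset ι} (hj : j ∉ H) (hA : A ⊆ H)
    (c : Finset ι → ℝ) :
    restrictVars (insert j H) (insert j A) c = restrictVars {j} {j} (restrictVars H A c) := by
  funext S
  have hjA : j ∉ A := fun h => hj (hA h)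
  by_cases h : j ∈ S
  · simp [restrictVars, h]
  · by_cases h' : Disjoint S H
    · have e : ({j} : Finset ι).powerset = {∅, {j}} := by
        ext R; simp [subset_singleton_iff]
      have hne : (∅ : Finset ι) ≠ {j} := (singleton_ne_empty j).symm
      have hd : Disjoint (S ∪ {j}) H := by
        rw [disjoint_union_left]; exact ⟨h', by simpa using hj⟩
      simp only [restrictVars, disjoint_insert_right, h, h', not_false_eq_true, and_self, if_true,
        disjoint_singleton_right, e, sum_pair hne, union_empty, hd]
      rw [sum_powerset_insert hjA]
      congr 1
      refine sum_congr rfl fun R _ => ?_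
      congr 1
      ext x; simp only [mem_union, mem_insert, mem_singleton]; tauto
    · simp only [restrictVars, disjoint_insert_right, h, h', not_false_eq_true, true_and, if_false,
        disjoint_singleton_right, if_true]
      symm
      refine sum_eq_zero fun R _ => if_neg fun hd => h' (disjoint_union_left.mp hd).1

lemma restrictVars_singleton_zero (c : Finset ι → ℝ) (j : ι) (S : Finset ι) :
    restrictVars {j} ∅ c S = if j ∈ S then 0 else c S := by
  by_cases h : j ∈ S <;> simp [restrictVars, h]

lemma restrictVars_singleton_one (c : Finset ι → ℝ) (j : ι) (S : Finset ι) :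
    restrictVars {j} {j} c S = if j ∈ S then 0 else c S + c (insert j S) := by
  by_cases h : j ∈ S
  · simp [restrictVars, h]
  · have e : ({j} : Finset ι).powerset = {∅, {j}} := by
      ext R; simp [subset_singleton_iff]
    have hne : (∅ : Finset ι) ≠ {j} := (singleton_ne_empty j).symm
    simp [restrictVars, h, e, sum_pair hne, union_singleton]

lemma zeta_restrictVars (c : Finset ι → ℝ) {H A : Finset ι} (hA : A ⊆ H) (T : Finset ι) :
    zeta (restrictVars H A c) T = zeta c ((T \ H) ∪ A) := by
  have hd : Disjoint (T \ H) A := (disjoint_sdiff.mono_left hA).symm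
  have h1 : zeta (restrictVars H A c) T =
      ∑ S ∈ (T \ H).powerset, ∑ R ∈ A.powerset, c (S ∪ R) := by
    unfold zeta restrictVars
    rw [← sum_filter]
    refine sum_congr ?_ fun _ _ => rfl
    ext S
    simp only [mem_filter, mem_powerset, subset_sdiff]
  rw [h1, zeta, ← sum_product']
  refine sum_bij' (fun p _ => p.1 ∪ p.2) (fun S _ => (S ∩ (T \ H), S ∩ A)) ?_ ?_ ?_ ?_ ?_
  · rintro ⟨S, R⟩ h
    simp only [mem_product, mem_powerset] at h ⊢
    exact union_subset_union h.1 h.2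
  · intro S _
    simp [inter_subset_right]
  · rintro ⟨S, R⟩ h
    simp only [mem_product, mem_powerset] at h
    have hSA : S ∩ A = ∅ := disjoint_iff_inter_eq_empty.mp (hd.mono_left h.1)
    have hRT : R ∩ (T \ H) = ∅ := disjoint_iff_inter_eq_empty.mp (hd.symm.mono_left h.2)
    simp only [union_inter_distrib_right, hSA, hRT, inter_eq_left.mpr h.1, inter_eq_left.mpr h.2,
      union_empty, empty_union]
  · intro S h
    rw [mem_powerset] at h
    simp only [← inter_union_distrib_left]
    exact inter_eq_left.mpr h
  · intro p _
    rfl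

lemma IsBoolean.restrictVars {c : Finset ι → ℝ} (hc : IsBoolean c) {H A : Finset ι} (hA : A ⊆ H) :
    IsBoolean (restrictVars H A c) := fun T => by
  rw [zeta_restrictVars c hA]; exact hc _

lemma exists_ne_of_restrictVars_ne_zero {c : Finset ι → ℝ} {H A S : Finset ι}
    (h : restrictVars H A c S ≠ 0) : Disjoint S H ∧ ∃ R ⊆ A, c (S ∪ R) ≠ 0 := by
  unfold restrictVars at h
  split_ifs at h with hd
  · obtain ⟨R, hR, hne⟩ := exists_ne_zero_of_sum_ne_zero h
    exact ⟨hd, R, mem_powerset.mp hR, hne⟩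
  · exact absurd rfl h

/-- If `H` meets every monomial of top degree, fixing the variables in `H` lowers the degree. -/
lemma DegreeLE.restrictVars_of_hitting {d : ℕ} {c : Finset ι → ℝ} (hc : DegreeLE (d + 1) c)
    {H : Finset ι} (hH : ∀ S, c S ≠ 0 → #S = d + 1 → ¬ Disjoint S H) (A : Finset ι) :
    DegreeLE d (BooleanJunta.restrictVars H A c) := fun S hS => by
  obtain ⟨hd, R, -, hne⟩ := exists_ne_of_restrictVars_ne_zero hS
  have h1 : #S ≤ #(S ∪ R) := card_le_card subset_union_left
  have h2 := hc _ hne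
  by_contra hlt
  have h3 : S = S ∪ R := eq_of_subset_of_card_le subset_union_left (by omega)
  rw [← h3] at hne
  exact hH S hne (by omega) hd

/-- The values on the cube determine the coefficients. -/
lemma eq_zero_of_zeta_eq_zero {c : Finset ι → ℝ} (h : ∀ T, zeta c T = 0) : c = 0 := by
  funext S
  induction S using Finset.strongInduction with
  | H S ih =>
    have hS := h S
    rw [zeta, ← sum_erase_add _ _ (mem_powerset_self S), sum_eq_zero, zero_add] at hS
    · exact hS
    · intro T hT
      rw [mem_erase, mem_powerset] at hT
      exact ih T (lt_of_le_of_ne hT.2 hT.1)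

/-! ### The weight of a variable and random restrictions -/

/-- `2 ^ (-deg_i)`, where `deg_i` is the largest degree of a monomial containing the variable `i`;
it is `0` if `i` occurs in no monomial. -/
noncomputable def varWeight [Fintype ι] (c : Finset ι → ℝ) (i : ι) : ℝ :=
  if ∃ S, i ∈ S ∧ c S ≠ 0 then ((2 : ℝ) ^ ({S | i ∈ S ∧ c S ≠ 0} : Finset (Finset ι)).sup card)⁻¹
  else 0

/-- The sum of the weights of all variables. -/
noncomputable def weight [Fintype ι] (c : Finset ι → ℝ) : ℝ := ∑ i, varWeight c i

variable [Fintype ι]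

lemma varWeight_nonneg (c : Finset ι → ℝ) (i : ι) : 0 ≤ varWeight c i := by
  unfold varWeight; split_ifs <;> positivity

lemma varWeight_eq_zero {c : Finset ι → ℝ} {i : ι} (h : ∀ S, i ∈ S → c S = 0) :
    varWeight c i = 0 := by
  unfold varWeight
  rw [if_neg]
  rintro ⟨S, hi, hS⟩
  exact hS (h S hi)

lemma le_varWeight {c : Finset ι → ℝ} {i : ι} {m : ℕ} (h : ∃ S, i ∈ S ∧ c S ≠ 0)
    (hm : ∀ S, i ∈ S → c S ≠ 0 → #S ≤ m) : ((2 : ℝ) ^ m)⁻¹ ≤ varWeight c i := by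
  unfold varWeight
  rw [if_pos h]
  gcongr
  · norm_num
  · refine Finset.sup_le fun S hS => ?_
    simp only [mem_filter, mem_univ, true_and] at hS
    exact hm S hS.1 hS.2

lemma varWeight_eq_of_card {c : Finset ι → ℝ} {i : ι} {M : Finset ι} (hi : i ∈ M) (hM : c M ≠ 0)
    (hm : ∀ S, i ∈ S → c S ≠ 0 → #S ≤ #M) : varWeight c i = ((2 : ℝ) ^ #M)⁻¹ := by
  unfold varWeight
  rw [if_pos ⟨M, hi, hM⟩]
  congr 2
  refine le_antisymm (Finset.sup_le fun S hS => ?_) (Finset.le_sup (f := card) (by simp [hi, hM]))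
  simp only [mem_filter, mem_univ, true_and] at hS
  exact hm S hS.1 hS.2

lemma varWeight_relevant {c : Finset ι → ℝ} {i : ι} (h : ∃ S, i ∈ S ∧ c S ≠ 0) :
    ∃ M, i ∈ M ∧ c M ≠ 0 ∧ (∀ S, i ∈ S → c S ≠ 0 → #S ≤ #M) ∧
      varWeight c i = ((2 : ℝ) ^ #M)⁻¹ := by
  have hne : ({S | i ∈ S ∧ c S ≠ 0} : Finset (Finset ι)).Nonempty := by
    obtain ⟨S, hS⟩ := h
    exact ⟨S, by simpa using hS⟩
  obtain ⟨M, hM, hmax⟩ := exists_max_image _ card hne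
  simp only [mem_filter, mem_univ, true_and] at hM hmax
  have hm : ∀ S, i ∈ S → c S ≠ 0 → #S ≤ #M := fun S h1 h2 => hmax S ⟨h1, h2⟩
  exact ⟨M, hM.1, hM.2, hm, varWeight_eq_of_card hM.1 hM.2 hm⟩

/-- Fixing another variable `j` at random does not decrease the expected weight of `i`: if `i`
becomes irrelevant for one value of `j`, then its degree drops for the other value. -/
lemma varWeight_le_half {c : Finset ι → ℝ} {i j : ι} (hij : i ≠ j) :
    varWeight c i ≤
      (varWeight (restrictVars {j} ∅ c) i + varWeight (restrictVars {j} {j} c) i) / 2 := by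
  have n0 := varWeight_nonneg (restrictVars {j} ∅ c) i
  have n1 := varWeight_nonneg (restrictVars {j} {j} c) i
  by_cases h : ∃ S, i ∈ S ∧ c S ≠ 0
  swap
  · rw [varWeight_eq_zero (c := c) fun S hS => by_contra fun hne => h ⟨S, hS, hne⟩]
    linarith
  obtain ⟨M, hiM, hM, hmax, hw⟩ := varWeight_relevant h
  have himem : ∀ {S : Finset ι}, i ∈ S → i ∈ insert j S := fun h => mem_insert_of_mem h
  have hcard : ∀ {S : Finset ι}, j ∉ S → i ∈ S → c (insert j S) ≠ 0 → #S + 1 ≤ #M := by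
    intro S hj hi hS
    have := hmax _ (himem hi) hS
    rwa [card_insert_of_notMem hj] at this
  have half : ∀ {a : ℝ}, ((2 : ℝ) ^ (#M - 1))⁻¹ ≤ a → ((2 : ℝ) ^ #M)⁻¹ ≤ a / 2 := by
    intro a ha
    have hpos : 0 < #M := card_pos.mpr ⟨i, hiM⟩
    obtain ⟨m, hm⟩ : ∃ m, #M = m + 1 := ⟨#M - 1, by omega⟩
    rw [hm, Nat.add_sub_cancel] at ha
    rw [hm, pow_succ, mul_inv]
    linarith
  rw [hw]
  by_cases h0 : ∃ S, i ∈ S ∧ restrictVars {j} ∅ c S ≠ 0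
  · by_cases h1 : ∃ S, i ∈ S ∧ restrictVars {j} {j} c S ≠ 0
    · have b0 : ((2 : ℝ) ^ #M)⁻¹ ≤ varWeight (restrictVars {j} ∅ c) i := by
        refine le_varWeight h0 fun S hi hS => ?_
        rw [restrictVars_singleton_zero] at hS
        split_ifs at hS with hj
        · exact absurd rfl hS
        · exact hmax S hi hS
      have b1 : ((2 : ℝ) ^ #M)⁻¹ ≤ varWeight (restrictVars {j} {j} c) i := by
        refine le_varWeight h1 fun S hi hS => ?_
        rw [restrictVars_singleton_one] at hS
        split_ifs at hS with hj
        · exact absurd rfl hS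
        · by_cases hcS : c S = 0
          · rw [hcS, zero_add] at hS
            exact (Nat.le_succ _).trans (hcard hj hi hS)
          · exact hmax S hi hcS
      linarith
    · -- the variable is irrelevant after `x_j = 1`: monomials come in pairs `S`, `S ∪ {j}`
      push Not at h1
      have hz : ∀ S, i ∈ S → j ∉ S → c S + c (insert j S) = 0 := fun S hi hj => by
        have := h1 S hi
        rwa [restrictVars_singleton_one, if_neg hj] at this
      have b0 : ((2 : ℝ) ^ (#M - 1))⁻¹ ≤ varWeight (restrictVars {j} ∅ c) i := by
        refine le_varWeight h0 fun S hi hS => ?_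
        rw [restrictVars_singleton_zero] at hS
        split_ifs at hS with hj
        · exact absurd rfl hS
        · have hne : c (insert j S) ≠ 0 := fun h' => hS (by have := hz S hi hj; linarith)
          have := hcard hj hi hne
          omega
      have := half b0
      linarith
  · -- the variable is irrelevant after `x_j = 0`: all its monomials contain `j`
    push Not at h0
    have hz : ∀ S, i ∈ S → j ∉ S → c S = 0 := fun S hi hj => by
      have := h0 S hi
      rwa [restrictVars_singleton_zero, if_neg hj] at this
    have hjM : j ∈ M := by_contra fun hj => hM (hz M hiM hj)
    have b1 : ((2 : ℝ) ^ (#M - 1))⁻¹ ≤ varWeight (restrictVars {j} {j} c) i := by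
      have hie : i ∈ M.erase j := mem_erase.mpr ⟨hij, hiM⟩
      refine le_varWeight ⟨M.erase j, hie, ?_⟩ fun S hi hS => ?_
      · rw [restrictVars_singleton_one, if_neg (notMem_erase j M), insert_erase hjM,
          hz _ hie (notMem_erase j M), zero_add]
        exact hM
      · rw [restrictVars_singleton_one] at hS
        split_ifs at hS with hj
        · exact absurd rfl hS
        · rw [hz S hi hj, zero_add] at hS
          have := hcard hj hi hS
          omega
    have := half b1
    linarith

/-- Fixing a set of other variables at random does not decrease the expected weight of `i`. -/
lemma varWeight_le_average (c : Finset ι → ℝ) {i : ι} {H : Finset ι} (hi : i ∉ H) :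
    varWeight c i ≤ ((2 : ℝ) ^ #H)⁻¹ * ∑ A ∈ H.powerset, varWeight (restrictVars H A c) i := by
  induction H using Finset.induction_on with
  | empty => simp
  | insert j H hj ih =>
    rw [mem_insert, not_or] at hi
    refine (ih hi.2).trans ?_
    rw [card_insert_of_notMem hj, sum_powerset_insert hj, pow_succ, mul_inv, mul_assoc]
    gcongr
    rw [← sum_add_distrib, mul_sum]
    refine sum_le_sum fun A hA => ?_
    rw [mem_powerset] at hA
    rw [restrictVars_insert_zero, restrictVars_insert_one hj hA]
    have := varWeight_le_half (c := restrictVars H A c) hi.1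
    linarith

/-- If all variables in `H` have weight at most `w`, fixing them at random decreases the expected
total weight by at most `#H * w`. -/
lemma weight_le_average {c : Finset ι → ℝ} {H : Finset ι} {w : ℝ}
    (hw : ∀ i ∈ H, varWeight c i ≤ w) :
    weight c ≤ #H * w + ((2 : ℝ) ^ #H)⁻¹ * ∑ A ∈ H.powerset, weight (restrictVars H A c) := by
  have h1 : weight c = ∑ i ∈ H, varWeight c i + ∑ i ∈ Hᶜ, varWeight c i :=
    (sum_add_sum_compl H _).symm
  have h2 : ∑ i ∈ H, varWeight c i ≤ #H * w := by
    rw [← nsmul_eq_mul]; exact sum_le_card_nsmul _ _ _ hw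
  have h3 : ∑ i ∈ Hᶜ, varWeight c i ≤
      ((2 : ℝ) ^ #H)⁻¹ * ∑ A ∈ H.powerset, weight (restrictVars H A c) := by
    calc ∑ i ∈ Hᶜ, varWeight c i
        ≤ ∑ i ∈ Hᶜ, ((2 : ℝ) ^ #H)⁻¹ *
            ∑ A ∈ H.powerset, varWeight (restrictVars H A c) i :=
          sum_le_sum fun i hi => varWeight_le_average c (mem_compl.mp hi)
      _ = ((2 : ℝ) ^ #H)⁻¹ * ∑ A ∈ H.powerset, ∑ i ∈ Hᶜ, varWeight (restrictVars H A c) i := by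
          rw [← mul_sum, sum_comm]
      _ ≤ _ := by
          gcongr with A _
          exact sum_le_univ_sum_of_nonneg fun i => varWeight_nonneg _ i
  linarith

end Weights

section Blocks

/-! ### Block sensitivity and monomials of top degree -/

variable {ι : Type} [DecidableEq ι]

/-- The block sensitivity of `f` is at most `b`: at every input, at most `b` pairwise disjoint
blocks have the property that flipping the block changes the value of `f`. -/
def BlockSensLE (f : Finset ι → ℝ) (b : ℕ) : Prop :=
  ∀ (κ : Type) [Fintype κ] (x : Finset ι) (β : κ → Finset ι), Pairwise (Function.onFun Disjoint β) →
    (∀ k, f (symmDiff x (β k)) ≠ f x) → Fintype.card κ ≤ b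

/-- Whatever the values of the other variables, the polynomial is not constant on the subcube
spanned by a monomial of top degree. -/
lemma exists_sensitive_subset [Fintype ι] {d : ℕ} {c : Finset ι → ℝ} (hc : DegreeLE d c)
    {M : Finset ι} (hM : c M ≠ 0) (hMd : #M = d) (hne : M.Nonempty) (x : Finset ι) :
    ∃ B ⊆ M, zeta c (symmDiff x B) ≠ zeta c x := by
  by_contra! hcon
  -- as `M` has top degree, its coefficient survives when all other variables are fixed
  set c' := restrictVars Mᶜ (x \ M) c with hc'
  have hsub : x \ M ⊆ Mᶜ := fun i hi => by
    rw [mem_sdiff] at hi; exact mem_compl.mpr hi.2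
  have hcoef : c' M = c M := by
    rw [hc', restrictVars, if_pos disjoint_compl_right, sum_eq_single ∅]
    · rw [union_empty]
    · intro R hR hR0
      by_contra hcR
      have h1 : #(M ∪ R) = #M + #R := by
        refine card_union_of_disjoint ?_
        exact disjoint_sdiff.mono_right (mem_powerset.mp hR)
      have h2 := hc _ hcR
      have h3 := card_pos.mpr (nonempty_iff_ne_empty.mpr hR0)
      omega
    · simp
  have hconst : ∀ T, zeta c' T = zeta c x := by
    intro T
    rw [hc', zeta_restrictVars c hsub, ← hcon (symmDiff (T ∩ M) (x ∩ M))]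
    · congr 1
      ext i
      simp only [mem_union, mem_sdiff, mem_compl, mem_symmDiff, mem_inter]
      tauto
    · intro i
      simp only [mem_symmDiff, mem_inter]
      tauto
  have hzero : (fun S => c' S - if S = ∅ then zeta c x else 0) = 0 := by
    refine eq_zero_of_zeta_eq_zero fun T => ?_
    have := hconst T
    unfold zeta at this ⊢
    rw [sum_sub_distrib, this, sum_ite_eq' T.powerset ∅, if_pos (empty_mem_powerset T), sub_self]
  have := congrFun hzero M
  simp only [Pi.zero_apply, if_neg hne.ne_empty, sub_zero, hcoef] at this
  exact hM this

/-- Fixing the variables of `#𝓜` disjoint monomials of top degree lowers the block sensitivity by at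
least `#𝓜`, because each of these monomials contains a further sensitive block. -/
lemma card_add_card_le [Fintype ι] {d b : ℕ} {c : Finset ι → ℝ} (hc : DegreeLE d c) (hd : 0 < d)
    {𝓜 : Finset (Finset ι)} (h𝓜 : ∀ M ∈ 𝓜, c M ≠ 0 ∧ #M = d)
    (hdisj : (𝓜 : Set (Finset ι)).PairwiseDisjoint id) (hb : BlockSensLE (zeta c) b)
    {A : Finset ι} (hA : A ⊆ 𝓜.biUnion id)
    (κ : Type) [Fintype κ] (x : Finset ι) (β : κ → Finset ι)
    (hβ : Pairwise (Function.onFun Disjoint β))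
    (hs : ∀ k, zeta (restrictVars (𝓜.biUnion id) A c) (symmDiff x (β k)) ≠
      zeta (restrictVars (𝓜.biUnion id) A c) x) :
    Fintype.card κ + #𝓜 ≤ b := by
  set H := 𝓜.biUnion id with hH
  set y := (x \ H) ∪ A with hy
  have hex : ∀ M : 𝓜, ∃ B ⊆ M.1, zeta c (symmDiff y B) ≠ zeta c y := fun M =>
    exists_sensitive_subset hc (h𝓜 M.1 M.2).1 (h𝓜 M.1 M.2).2
      (card_pos.mp (by rw [(h𝓜 M.1 M.2).2]; exact hd)) y
  choose B hBM hB using hex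
  have hMH : ∀ M : 𝓜, B M ⊆ H := fun M =>
    (hBM M).trans (subset_biUnion_of_mem (u := id) M.2)
  have hmain := hb (κ ⊕ 𝓜) y (Sum.elim (fun k => β k \ H) B) ?_ ?_
  · simpa [Fintype.card_sum] using hmain
  · rintro (k | M) (l | N) hne
    · exact (hβ fun h => hne (by rw [h])).mono sdiff_subset sdiff_subset
    · exact disjoint_sdiff.symm.mono_right (hMH N)
    · exact disjoint_sdiff.mono_left (hMH M)
    · refine Disjoint.mono (hBM M) (hBM N) (hdisj M.2 N.2 fun h => hne ?_)
      rw [Subtype.ext h]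
  · rintro (k | M)
    · have := hs k
      rw [zeta_restrictVars c hA, zeta_restrictVars c hA] at this
      convert this using 2
      ext i
      have hi : i ∈ A → i ∈ H := fun h => hA h
      simp only [Sum.elim_inl, hy, mem_union, mem_sdiff, mem_symmDiff]
      tauto
    · exact hB M

/-- A maximal family of disjoint sets with the property `P`; its union meets every set with this
property. -/
lemma exists_maximal_disjoint [Fintype ι] (P : Finset ι → Prop) (hP : ∀ S, P S → S.Nonempty) :
    ∃ 𝓜 : Finset (Finset ι), (∀ M ∈ 𝓜, P M) ∧ (𝓜 : Set (Finset ι)).PairwiseDisjoint id ∧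
      ∀ S, P S → ¬ Disjoint S (𝓜.biUnion id) := by
  classical
  have hne : ({𝓜 | (∀ M ∈ 𝓜, P M) ∧ (𝓜 : Set (Finset ι)).PairwiseDisjoint id} :
      Finset (Finset (Finset ι))).Nonempty := ⟨∅, by simp⟩
  obtain ⟨𝓜, h𝓜, hmax⟩ := exists_max_image _ card hne
  simp only [mem_filter, mem_univ, true_and] at h𝓜 hmax
  refine ⟨𝓜, h𝓜.1, h𝓜.2, fun S hS hd => ?_⟩
  have hSM : ∀ M ∈ 𝓜, Disjoint S M := fun M hM => by
    rw [disjoint_biUnion_right] at hd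
    exact hd M hM
  have hnot : S ∉ 𝓜 := fun h => (hP S hS).ne_empty (disjoint_self.mp (hSM S h))
  have := hmax (insert S 𝓜) ⟨?_, ?_⟩
  · rw [card_insert_of_notMem hnot] at this
    omega
  · intro M hM
    rcases mem_insert.mp hM with rfl | h
    · exact hS
    · exact h𝓜.1 M h
  · rw [coe_insert]
    exact h𝓜.2.insert fun M hM _ => hSM M hM

/-- Passing from degree `d` to degree `d + 1`. If Boolean functions of degree at most `d` satisfy
`weight ≤ u` and `weight ≤ a + s * bs`, then those of degree at most `d + 1` satisfy
`weight ≤ a' + (d + 1) / 2 ^ (d + 1) * bs`, where `a'` comes from averaging the two bounds so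
that the slope `s` becomes `(d + 1) / 2 ^ (d + 1)`. -/
lemma weight_le_succ {d : ℕ} {a s u θ a' : ℝ} (hθ0 : 0 ≤ θ) (hθ1 : θ ≤ 1)
    (hθ : θ * s = (d + 1 : ℕ) / (2 : ℝ) ^ (d + 1)) (ha' : (1 - θ) * u + θ * a ≤ a')
    (hu : ∀ (n : ℕ) (c : Finset (Fin n) → ℝ), IsBoolean c → DegreeLE d c → weight c ≤ u)
    (ha : ∀ (n : ℕ) (c : Finset (Fin n) → ℝ), IsBoolean c → DegreeLE d c →
      ∀ b, BlockSensLE (zeta c) b → weight c ≤ a + s * b)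
    (n : ℕ) (c : Finset (Fin n) → ℝ) (hc : IsBoolean c) (hd : DegreeLE (d + 1) c) (b : ℕ)
    (hb : BlockSensLE (zeta c) b) :
    weight c ≤ a' + (d + 1 : ℕ) / (2 : ℝ) ^ (d + 1) * b := by
  obtain ⟨𝓜, h𝓜, hdisj, hmax⟩ := exists_maximal_disjoint (fun S => c S ≠ 0 ∧ #S = d + 1)
    fun S hS => card_pos.mp (by omega)
  set H := 𝓜.biUnion id with hH
  have hcard : #H = #𝓜 * (d + 1) :=
    (card_biUnion hdisj).trans (sum_const_nat fun M hM => (h𝓜 M hM).2)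
  have hw : ∀ i ∈ H, varWeight c i ≤ ((2 : ℝ) ^ (d + 1))⁻¹ := by
    intro i hi
    obtain ⟨M, hM, hiM⟩ := mem_biUnion.mp hi
    rw [id] at hiM
    rw [varWeight_eq_of_card hiM (h𝓜 M hM).1 fun S _ hS => (hd S hS).trans (h𝓜 M hM).2.ge,
      (h𝓜 M hM).2]
  have hrec : ∀ A ∈ H.powerset, weight (restrictVars H A c) ≤ a' + θ * s * (b - #𝓜) := by
    intro A hA
    rw [mem_powerset] at hA
    have hdeg : DegreeLE d (restrictVars H A c) :=
      hd.restrictVars_of_hitting (fun S h1 h2 => hmax S ⟨h1, h2⟩) A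
    have hblk := card_add_card_le hd (Nat.succ_pos d) h𝓜 hdisj hb hA
    have hle : #𝓜 ≤ b := by
      have := hblk Empty ∅ (fun e => e.elim) (fun e => e.elim) (fun e => e.elim)
      omega
    have hbs : BlockSensLE (zeta (restrictVars H A c)) (b - #𝓜) := by
      intro κ _ x β hβ hs
      have := hblk κ x β hβ hs
      omega
    have h1 := hu n _ (hc.restrictVars hA) hdeg
    have h2 := ha n _ (hc.restrictVars hA) hdeg _ hbs
    rw [Nat.cast_sub hle] at h2
    have h3 := mul_le_mul_of_nonneg_left h1 (sub_nonneg.mpr hθ1)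
    have h4 := mul_le_mul_of_nonneg_left h2 hθ0
    linarith
  refine (weight_le_average hw).trans ?_
  have hsum := sum_le_card_nsmul _ _ _ hrec
  rw [card_powerset, nsmul_eq_mul] at hsum
  push_cast at hsum
  have hpow : (0 : ℝ) < ((2 : ℝ) ^ #H)⁻¹ := by positivity
  have h5 := mul_le_mul_of_nonneg_left hsum hpow.le
  rw [← mul_assoc, inv_mul_cancel₀ (by positivity), one_mul] at h5
  have h6 : (#H : ℝ) * ((2 : ℝ) ^ (d + 1))⁻¹ = θ * s * #𝓜 := by
    rw [hθ, hcard]; push_cast; ring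
  rw [h6, ← hθ]
  linarith

end Blocks

section Influences

/-! ### Influences -/

variable {ι : Type} [DecidableEq ι] [Fintype ι]

/-- The character `T ↦ (-1) ^ #(S ∩ T)` of the cube. -/
def character (S T : Finset ι) : ℝ := ∏ j, if j ∈ S ∧ j ∈ T then -1 else 1

lemma character_eq_left (S T : Finset ι) :
    character S T = ∏ j ∈ S, if j ∈ T then (-1 : ℝ) else 1 := by
  unfold character
  simp_rw [ite_and]
  rw [Finset.prod_ite_mem, univ_inter]

lemma character_eq_right (S T : Finset ι) :
    character S T = ∏ j ∈ T, if j ∈ S then (-1 : ℝ) else 1 := by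
  rw [← character_eq_left]
  unfold character
  simp_rw [and_comm]

lemma character_flip (S T : Finset ι) (i : ι) :
    character S (symmDiff T {i}) = (if i ∈ S then -1 else 1) * character S T := by
  unfold character
  rw [← mul_prod_erase univ _ (mem_univ i), ← mul_prod_erase univ _ (mem_univ i), ← mul_assoc]
  congr 1
  · by_cases hS : i ∈ S <;> by_cases hT : i ∈ T <;> simp [hS, hT, mem_symmDiff]
  · refine prod_congr rfl fun j hj => ?_
    have hne : j ≠ i := ne_of_mem_erase hj
    simp [mem_symmDiff, hne]

lemma sum_character_mul (S S' : Finset ι) :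
    ∑ T, character S T * character S' T = if S = S' then (2 : ℝ) ^ Fintype.card ι else 0 := by
  have h : ∑ T, character S T * character S' T =
      ∏ j, (1 + (if j ∈ S then (-1 : ℝ) else 1) * (if j ∈ S' then -1 else 1)) := by
    rw [prod_one_add, powerset_univ]
    refine sum_congr rfl fun T _ => ?_
    rw [character_eq_right, character_eq_right, prod_mul_distrib]
  rw [h]
  split_ifs with hS
  · subst hS
    rw [← card_univ, ← prod_const]
    refine prod_congr rfl fun j _ => ?_
    split_ifs <;> norm_num
  · have hex : ∃ j, ¬ (j ∈ S ↔ j ∈ S') := by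
      by_contra! hcon
      exact hS (Finset.ext hcon)
    obtain ⟨j, hj⟩ := hex
    refine prod_eq_zero (mem_univ j) ?_
    by_cases h1 : j ∈ S <;> by_cases h2 : j ∈ S' <;> simp_all

/-- Parseval's identity on the cube. -/
lemma sum_sq_character (b : Finset ι → ℝ) :
    ∑ T, (∑ S, b S * character S T) ^ 2 = (2 : ℝ) ^ Fintype.card ι * ∑ S, b S ^ 2 := by
  calc ∑ T, (∑ S, b S * character S T) ^ 2
      = ∑ T, ∑ S, ∑ S', b S * b S' * (character S T * character S' T) := by
        refine sum_congr rfl fun T _ => ?_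
        rw [sq, sum_mul_sum]
        refine sum_congr rfl fun S _ => sum_congr rfl fun S' _ => ?_
        ring
    _ = ∑ S, ∑ S', b S * b S' * ∑ T, character S T * character S' T := by
        rw [sum_comm]
        refine sum_congr rfl fun S _ => ?_
        rw [sum_comm]
        exact sum_congr rfl fun S' _ => (mul_sum _ _ _).symm
    _ = ∑ S, b S * b S * (2 : ℝ) ^ Fintype.card ι := by
        refine sum_congr rfl fun S _ => ?_
        simp only [sum_character_mul, mul_ite, mul_zero, sum_ite_eq, mem_univ, if_true]
    _ = _ := by
        rw [mul_sum]
        exact sum_congr rfl fun S _ => by ring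

/-- The Fourier expansion of a polynomial of degree at most `d` uses only characters of level at
most `d`. -/
lemma zeta_eq_sum_character {d : ℕ} {c : Finset ι → ℝ} (hc : DegreeLE d c) :
    ∃ b : Finset ι → ℝ, DegreeLE d b ∧ ∀ T, zeta c T = ∑ S, b S * character S T := by
  refine ⟨fun R => ∑ S, if R ⊆ S then c S * ((-(1 / 2)) ^ #R * (1 / 2) ^ #(S \ R)) else 0,
    fun R hR => ?_, fun T => ?_⟩
  · obtain ⟨S, -, hS⟩ := exists_ne_zero_of_sum_ne_zero hR
    split_ifs at hS with hRS
    · exact (card_le_card hRS).trans (hc S (left_ne_zero_of_mul hS))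
    · exact absurd rfl hS
  · have hmono : ∀ S : Finset ι, (if S ⊆ T then (1 : ℝ) else 0) =
        ∑ R, if R ⊆ S then (-(1 / 2)) ^ #R * (1 / 2) ^ #(S \ R) * character R T else 0 := by
      intro S
      have h1 : (if S ⊆ T then (1 : ℝ) else 0) =
          ∏ j ∈ S, ((-(1 / 2)) * (if j ∈ T then (-1 : ℝ) else 1) + 1 / 2) := by
        split_ifs with h
        · refine (prod_eq_one fun j hj => ?_).symm
          rw [if_pos (h hj)]; norm_num
        · obtain ⟨j, hj, hjT⟩ := not_subset.mp h
          refine (prod_eq_zero hj ?_).symm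
          rw [if_neg hjT]; norm_num
      rw [h1, prod_add, ← sum_filter]
      refine sum_congr (by ext R; simp) fun R _ => ?_
      rw [prod_mul_distrib, prod_const, prod_const, character_eq_left]
      ring
    have hz : zeta c T = ∑ S, c S * if S ⊆ T then (1 : ℝ) else 0 := by
      unfold zeta
      simp_rw [mul_ite, mul_one, mul_zero]
      rw [← sum_filter]
      exact sum_congr (by ext R; simp) fun _ _ => rfl
    rw [hz]
    simp_rw [hmono, mul_sum, sum_mul]
    rw [sum_comm]
    refine sum_congr rfl fun R _ => sum_congr rfl fun S _ => ?_
    split_ifs <;> ring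

/-- The total influence of a Boolean function is at most its degree. -/
lemma sum_card_sensitive_le {d : ℕ} {c : Finset ι → ℝ} (hB : IsBoolean c) (hc : DegreeLE d c) :
    ∑ i, (#{T | zeta c (symmDiff T {i}) ≠ zeta c T} : ℝ) ≤ d * 2 ^ Fintype.card ι := by
  -- pass to the function `F = 1 - 2 f` with values `±1`
  set c' : Finset ι → ℝ := fun S => (if S = ∅ then 1 else 0) - 2 * c S with hc'
  have hdeg : DegreeLE d c' := fun S hS => by
    by_cases h : S = ∅
    · simp [h]
    · refine hc S fun h0 => hS ?_
      simp [hc', h, h0]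
  have hz : ∀ T, zeta c' T = 1 - 2 * zeta c T := fun T => by
    unfold zeta
    rw [hc', sum_sub_distrib, sum_ite_eq', if_pos (empty_mem_powerset T), mul_sum]
  obtain ⟨b, hb, hF⟩ := zeta_eq_sum_character hdeg
  have hN : (0 : ℝ) < 2 ^ Fintype.card ι := by positivity
  have hone : ∑ S, b S ^ 2 = 1 := by
    have h := sum_sq_character b
    have h2 : ∑ T : Finset ι, (∑ S, b S * character S T) ^ 2 = (2 : ℝ) ^ Fintype.card ι := by
      have : ∀ T : Finset ι, (∑ S, b S * character S T) ^ 2 = 1 := fun T => by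
        rw [← hF, hz]
        rcases hB T with h | h <;> rw [h] <;> norm_num
      simp [this]
    rw [h2] at h
    exact mul_left_cancel₀ hN.ne' (by rw [← h, mul_one])
  have hinf : ∀ i, (#{T | zeta c (symmDiff T {i}) ≠ zeta c T} : ℝ) =
      2 ^ Fintype.card ι * ∑ S, if i ∈ S then b S ^ 2 else 0 := by
    intro i
    have h := sum_sq_character fun S => if i ∈ S then b S else 0
    have h1 : ∀ S, (if i ∈ S then b S else 0) ^ 2 = if i ∈ S then b S ^ 2 else 0 := fun S => by
      split_ifs <;> simp
    simp_rw [h1] at h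
    rw [← h, card_filter, Nat.cast_sum]
    refine sum_congr rfl fun T _ => ?_
    have h2 : ∑ S, (if i ∈ S then b S else 0) * character S T =
        (zeta c' T - zeta c' (symmDiff T {i})) / 2 := by
      rw [hF, hF, ← sum_sub_distrib, sum_div]
      refine sum_congr rfl fun S _ => ?_
      rw [character_flip]
      split_ifs <;> ring
    rw [h2, hz, hz]
    rcases hB T with h | h <;> rcases hB (symmDiff T {i}) with h' | h' <;> rw [h, h'] <;> norm_num
  simp_rw [hinf]
  rw [← mul_sum, mul_comm]
  gcongr
  rw [sum_comm]
  calc ∑ S, ∑ i, (if i ∈ S then b S ^ 2 else 0)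
      = ∑ S, #S * b S ^ 2 := by
        refine sum_congr rfl fun S _ => ?_
        rw [← sum_filter, sum_const, nsmul_eq_mul]
        simp
    _ ≤ ∑ S, d * b S ^ 2 := by
        refine sum_le_sum fun S _ => ?_
        by_cases h : b S = 0
        · simp [h]
        · gcongr
          exact hb S h
    _ = d := by rw [← mul_sum, hone, mul_one]

/-- The weight of a variable is at most half its influence: fix all other variables at random. -/
lemma varWeight_le_influence (c : Finset ι → ℝ) (i : ι) :
    varWeight c i ≤
      (#{T | zeta c (symmDiff T {i}) ≠ zeta c T} : ℝ) / (2 * 2 ^ Fintype.card ι) := by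
  set s : Finset ι → ℝ := fun T => if zeta c (symmDiff T {i}) ≠ zeta c T then 1 else 0 with hs
  have hsum : (#{T | zeta c (symmDiff T {i}) ≠ zeta c T} : ℝ) =
      2 * ∑ A ∈ (univ.erase i).powerset, s A := by
    rw [card_filter, Nat.cast_sum, ← powerset_univ, ← insert_erase (mem_univ i),
      sum_powerset_insert (notMem_erase i univ), two_mul]
    congr 1
    · refine sum_congr (by simp) fun A _ => ?_
      simp [hs]
    · refine sum_congr (by simp) fun A hA => ?_
      have hi : i ∉ A := fun h => by simpa using mem_powerset.mp hA h
      have h1 : symmDiff (insert i A) {i} = A := by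
        ext j; by_cases h : j = i <;> simp [mem_symmDiff, h, hi]
      have h2 : symmDiff A {i} = insert i A := by
        ext j; by_cases h : j = i <;> simp [mem_symmDiff, h, hi]
      simp only [hs, h1, h2, ne_comm (a := zeta c A)]
      split_ifs <;> simp
  have hw : ∀ A ∈ (univ.erase i).powerset,
      varWeight (restrictVars (univ.erase i) A c) i ≤ s A / 2 := by
    intro A hA
    rw [mem_powerset] at hA
    set c' := restrictVars (univ.erase i) A c with hc'
    have hsupp : ∀ S, i ∈ S → c' S ≠ 0 → S = {i} := by
      intro S hi hS
      obtain ⟨hd, -⟩ := exists_ne_of_restrictVars_ne_zero hS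
      refine eq_singleton_iff_unique_mem.mpr ⟨hi, fun j hj => by_contra fun hne => ?_⟩
      exact disjoint_left.mp hd hj (mem_erase.mpr ⟨hne, mem_univ j⟩)
    by_cases h0 : c' {i} = 0
    · rw [varWeight_eq_zero fun S hi => by_contra fun hS => hS (by rw [hsupp S hi hS, h0])]
      simp only [hs]
      split_ifs <;> norm_num
    · rw [varWeight_eq_of_card (mem_singleton_self i) h0 fun S hi hS => by rw [hsupp S hi hS]]
      have hi : i ∉ A := fun h => by simpa using hA h
      have h2 : symmDiff A {i} = insert i A := by
        ext j; by_cases h : j = i <;> simp [mem_symmDiff, h, hi]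
      have hz1 : zeta c' {i} = zeta c (insert i A) := by
        rw [hc', zeta_restrictVars c hA]
        congr 1
        ext j; by_cases h : j = i <;> simp [h]
      have hz0 : zeta c' ∅ = zeta c A := by
        rw [hc', zeta_restrictVars c hA]
        simp
      have hdiff : zeta c' {i} = zeta c' ∅ + c' {i} := by
        have := zeta_insert c' (notMem_empty i)
        simpa using this
      have hne : zeta c (symmDiff A {i}) ≠ zeta c A := by
        rw [h2, ← hz1, ← hz0, hdiff]
        simpa using h0
      simp [hs, hne]
  have h := varWeight_le_average c (notMem_erase i univ)
  refine h.trans ?_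
  have hcard : Fintype.card ι = #(univ.erase i) + 1 := by
    rw [← card_univ, card_erase_add_one (mem_univ i)]
  rw [hsum, hcard, pow_succ]
  have hle := sum_le_sum hw
  rw [← sum_div] at hle
  have hpos : (0 : ℝ) < 2 ^ #(univ.erase i) := by positivity
  rw [inv_mul_le_iff₀ hpos]
  refine hle.trans (le_of_eq ?_)
  field_simp

/-- The weight of a Boolean function is at most half its degree. -/
lemma weight_le_half_degree {d : ℕ} {c : Finset ι → ℝ} (hB : IsBoolean c) (hc : DegreeLE d c) :
    weight c ≤ d / 2 := by
  refine (sum_le_sum fun i _ => varWeight_le_influence c i).trans ?_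
  rw [← sum_div, div_le_iff₀ (by positivity)]
  refine (sum_card_sensitive_le hB hc).trans (le_of_eq ?_)
  ring

end Influences

section Symmetrization

open Polynomial

/-! ### Symmetrization of a family of blocks -/

/-- The functions on the cube `Finset κ` that are given by polynomials of degree at most `d`. -/
def polySpace (κ : Type) [DecidableEq κ] (d : ℕ) : Submodule ℝ (Finset κ → ℝ) :=
  Submodule.span ℝ {m | ∃ S : Finset κ, #S ≤ d ∧ m = fun J => if S ⊆ J then 1 else 0}

section

variable {κ : Type} [DecidableEq κ]

lemma mono_mem_polySpace {d : ℕ} {S : Finset κ} (hS : #S ≤ d) :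
    (fun J => if S ⊆ J then (1 : ℝ) else 0) ∈ polySpace κ d :=
  Submodule.subset_span ⟨S, hS, rfl⟩

lemma const_mem_polySpace (d : ℕ) (a : ℝ) : (fun _ : Finset κ => a) ∈ polySpace κ d := by
  have := (polySpace κ d).smul_mem a (mono_mem_polySpace (S := ∅) (Nat.zero_le d))
  convert this using 1
  funext J
  simp

lemma mul_mem_polySpace {a b : ℕ} {f g : Finset κ → ℝ} (hf : f ∈ polySpace κ a)
    (hg : g ∈ polySpace κ b) : f * g ∈ polySpace κ (a + b) := by
  have h := Submodule.mul_mem_mul hf hg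
  unfold polySpace at h
  rw [Submodule.span_mul_span] at h
  refine Submodule.span_le.mpr ?_ h
  rintro _ ⟨_, ⟨S, hS, rfl⟩, _, ⟨S', hS', rfl⟩, rfl⟩
  refine Submodule.subset_span ⟨S ∪ S', (card_union_le _ _).trans (by omega), ?_⟩
  funext J
  by_cases h1 : S ⊆ J <;> by_cases h2 : S' ⊆ J <;> simp [h1, h2, union_subset_iff]

lemma indicator_mem_polySpace {ι : Type} [DecidableEq ι] (x : Finset ι) {β : κ → Finset ι}
    (hβ : Pairwise (Function.onFun Disjoint β)) (e : ι) :
    (fun J : Finset κ => if e ∈ symmDiff x (J.biUnion β) then (1 : ℝ) else 0) ∈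
      polySpace κ 1 := by
  by_cases h : ∃ k, e ∈ β k
  · obtain ⟨k, hk⟩ := h
    have huniq : ∀ l, e ∈ β l → l = k := fun l hl => by_contra fun hne =>
      disjoint_left.mp (hβ hne) hl hk
    have hmem : ∀ J : Finset κ, e ∈ J.biUnion β ↔ k ∈ J := fun J => by
      rw [mem_biUnion]
      exact ⟨fun ⟨l, hl, he⟩ => huniq l he ▸ hl, fun hkJ => ⟨k, hkJ, hk⟩⟩
    have hm := mono_mem_polySpace (κ := κ) (S := {k}) (d := 1) (by simp)
    by_cases hx : e ∈ x
    · convert (polySpace κ 1).sub_mem (const_mem_polySpace 1 1) hm using 1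
      funext J
      by_cases hJ : k ∈ J <;> simp [mem_symmDiff, hmem, hx, hJ, -mem_biUnion]
    · convert hm using 1
      funext J
      by_cases hJ : k ∈ J <;> simp [mem_symmDiff, hmem, hx, hJ, -mem_biUnion]
  · convert const_mem_polySpace (κ := κ) 1 (if e ∈ x then 1 else 0) using 1
    funext J
    have hmem : e ∉ J.biUnion β := fun he => by
      obtain ⟨l, -, hl⟩ := mem_biUnion.mp he
      exact h ⟨l, hl⟩
    simp [mem_symmDiff, hmem, -mem_biUnion]

/-- Restricting a polynomial to the subcube `J ↦ x ∆ ⋃ k ∈ J, β k` does not increase the degree. -/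
lemma zeta_block_mem_polySpace {ι : Type} [DecidableEq ι] [Fintype ι] {d : ℕ} {c : Finset ι → ℝ}
    (hc : DegreeLE d c) (x : Finset ι) {β : κ → Finset ι}
    (hβ : Pairwise (Function.onFun Disjoint β)) :
    (fun J : Finset κ => zeta c (symmDiff x (J.biUnion β))) ∈ polySpace κ d := by
  have hS : ∀ S : Finset ι,
      (fun J : Finset κ => if S ⊆ symmDiff x (J.biUnion β) then (1 : ℝ) else 0) ∈
        polySpace κ #S := by
    intro S
    induction S using Finset.induction_on with
    | empty => simpa using const_mem_polySpace (κ := κ) 0 1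
    | insert e S he ih =>
      rw [card_insert_of_notMem he]
      convert mul_mem_polySpace ih (indicator_mem_polySpace x hβ e) using 1
      funext J
      by_cases h1 : S ⊆ symmDiff x (J.biUnion β) <;>
        by_cases h2 : e ∈ symmDiff x (J.biUnion β) <;>
          simp [h1, h2, insert_subset_iff]
  have hz : (fun J : Finset κ => zeta c (symmDiff x (J.biUnion β))) =
      ∑ S, c S • fun J : Finset κ => if S ⊆ symmDiff x (J.biUnion β) then (1 : ℝ) else 0 := by
    funext J
    rw [Finset.sum_apply]
    simp only [Pi.smul_apply, smul_eq_mul, mul_ite, mul_one, mul_zero]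
    rw [← sum_filter, zeta]
    exact sum_congr (by ext R; simp) fun _ _ => rfl
  rw [hz]
  refine Submodule.sum_mem _ fun S _ => ?_
  by_cases h0 : c S = 0
  · rw [h0, zero_smul]; exact Submodule.zero_mem _
  · refine Submodule.smul_mem _ _ ?_
    refine Submodule.span_mono ?_ (hS S)
    rintro m ⟨R, hR, rfl⟩
    exact ⟨R, hR.trans (hc S h0), rfl⟩

/-- Averaging over the inputs with exactly `t` ones turns a polynomial of degree at most `d` on the
cube into a polynomial of degree at most `d` in `t`. -/
lemma exists_symmetrization [Fintype κ] {d : ℕ} {g : Finset κ → ℝ} (hg : g ∈ polySpace κ d) :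
    ∃ p : ℝ[X], p.natDegree ≤ d ∧ ∀ t ≤ Fintype.card κ,
      p.eval (t : ℝ) = (∑ J ∈ powersetCard t univ, g J) / (Fintype.card κ).choose t := by
  induction hg using Submodule.span_induction with
  | mem m hm =>
    obtain ⟨S, hS, rfl⟩ := hm
    refine ⟨C (((Fintype.card κ).choose #S * (#S).factorial : ℝ)⁻¹) * descPochhammer ℝ #S,
      ?_, fun t ht => ?_⟩
    · refine (natDegree_C_mul_le _ _).trans ?_
      rw [descPochhammer_natDegree]
      exact hS
    · have hSK : #S ≤ Fintype.card κ := card_le_univ S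
      have hpos : (0 : ℝ) < (Fintype.card κ).choose t := by exact_mod_cast Nat.choose_pos ht
      have hposS : (0 : ℝ) < (Fintype.card κ).choose #S := by exact_mod_cast Nat.choose_pos hSK
      have hfac : (0 : ℝ) < (#S).factorial := by exact_mod_cast Nat.factorial_pos _
      rw [eval_mul, eval_C, descPochhammer_eval_eq_descFactorial, ← sum_filter, sum_const,
        nsmul_eq_mul, mul_one, Nat.descFactorial_eq_factorial_mul_choose, eq_div_iff hpos.ne']
      rcases le_or_gt #S t with hSt | hSt
      · rw [card_filter_powersetCard_subset S univ t (subset_univ S) hSt, card_univ]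
        have hmul : ((Fintype.card κ).choose t * t.choose #S : ℝ) =
            (Fintype.card κ).choose #S * (Fintype.card κ - #S).choose (t - #S) := by
          exact_mod_cast Nat.choose_mul hSt
        push_cast
        field_simp
        linarith
      · rw [Nat.choose_eq_zero_of_lt hSt, filter_eq_empty_iff.mpr]
        · simp
        · intro J hJ hSJ
          have h1 := card_le_card hSJ
          rw [(mem_powersetCard.mp hJ).2] at h1
          omega
  | zero => exact ⟨0, by simp, by simp⟩
  | add f g _ _ hf hg =>
    obtain ⟨p, hp, hpe⟩ := hf
    obtain ⟨q, hq, hqe⟩ := hg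
    refine ⟨p + q, (natDegree_add_le _ _).trans (max_le hp hq), fun t ht => ?_⟩
    rw [eval_add, hpe t ht, hqe t ht, ← add_div, ← sum_add_distrib]
    rfl
  | smul a f _ hf =>
    obtain ⟨p, hp, hpe⟩ := hf
    refine ⟨C a * p, (natDegree_C_mul_le _ _).trans hp, fun t ht => ?_⟩
    rw [eval_mul, eval_C, hpe t ht, ← mul_div_assoc, mul_sum]
    rfl

end

/-- From `K` sensitive blocks of a Boolean function of degree at most `d` one obtains a univariate
polynomial `q` of degree at most `d` with `q 0 = 1`, `q 1 = 0` and `0 ≤ q t ≤ 1` for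
`t = 0, …, K`: the average, over all unions of `t` blocks, of the indicator that flipping them
does not change the value. -/
lemma exists_block_polynomial {ι κ : Type} [DecidableEq ι] [Fintype ι] [Fintype κ] {d : ℕ}
    {c : Finset ι → ℝ} (hB : IsBoolean c) (hc : DegreeLE d c) (x : Finset ι) {β : κ → Finset ι}
    (hβ : Pairwise (Function.onFun Disjoint β))
    (hs : ∀ k, zeta c (symmDiff x (β k)) ≠ zeta c x) (hκ : 1 ≤ Fintype.card κ) :
    ∃ q : ℝ[X], q.natDegree ≤ d ∧ q.eval 0 = 1 ∧ q.eval 1 = 0 ∧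
      ∀ t : ℕ, t ≤ Fintype.card κ → 0 ≤ q.eval (t : ℝ) ∧ q.eval (t : ℝ) ≤ 1 := by
  classical
  set f : Finset κ → ℝ := fun J => zeta c (symmDiff x (J.biUnion β)) with hf
  set g : Finset κ → ℝ := fun J => if f J = f ∅ then 1 else 0 with hg
  have hB' : ∀ J, f J = 0 ∨ f J = 1 := fun J => hB _
  have hmem : g ∈ polySpace κ d := by
    have hz := zeta_block_mem_polySpace hc x hβ
    rcases hB' ∅ with h | h
    · convert (polySpace κ d).sub_mem (const_mem_polySpace d 1) hz using 1
      funext J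
      show g J = 1 - f J
      rcases hB' J with h' | h' <;> simp [hg, h, h']
    · convert hz using 1
      funext J
      show g J = f J
      rcases hB' J with h' | h' <;> simp [hg, h, h']
  obtain ⟨q, hq, hqe⟩ := exists_symmetrization hmem
  have hg01 : ∀ J, 0 ≤ g J ∧ g J ≤ 1 := fun J => by
    simp only [hg]; split_ifs <;> norm_num
  refine ⟨q, hq, ?_, ?_, fun t ht => ?_⟩
  · have := hqe 0 (Nat.zero_le _)
    rw [Nat.cast_zero] at this
    rw [this, powersetCard_zero, sum_singleton]
    simp [hg]
  · have := hqe 1 hκ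
    rw [Nat.cast_one] at this
    rw [this, sum_eq_zero, zero_div]
    intro J hJ
    obtain ⟨k, rfl⟩ := card_eq_one.mp (mem_powersetCard.mp hJ).2
    have hk : f {k} ≠ f ∅ := by
      simp only [hf, singleton_biUnion, biUnion_empty]
      rw [show symmDiff x ∅ = x from symmDiff_bot x]
      exact hs k
    simp [hg, hk]
  · rw [hqe t ht]
    have hpos : (0 : ℝ) < (Fintype.card κ).choose t := by exact_mod_cast Nat.choose_pos ht
    refine ⟨div_nonneg (sum_nonneg fun J _ => (hg01 J).1) hpos.le, ?_⟩
    rw [div_le_one hpos]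
    refine (sum_le_card_nsmul _ _ 1 fun J _ => (hg01 J).2).trans ?_
    rw [card_powersetCard, card_univ, nsmul_eq_mul, mul_one]

/-! ### Bounds for the block sensitivity in terms of the degree -/

/-- The denominator of the weight of `v i` in the divided difference at the nodes `v`. -/
def nodeProd {m : ℕ} (v : Fin m → ℤ) (i : Fin m) : ℤ := ∏ j ∈ univ.erase i, (v i - v j)

/-- The divided difference of `q` at the nodes vanishes, which is impossible for the polynomial of
`exists_block_polynomial` if the nodes other than `0` and `1` whose weight has the sign opposite
to that of the node `0` have too little weight. This is tested in integer arithmetic: each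
quotient of weights is multiplied by `N` and rounded up. -/
lemma blockSensLE_of_nodes {ι : Type} [DecidableEq ι] [Fintype ι] {d b : ℕ} {c : Finset ι → ℝ}
    (hB : IsBoolean c) (hc : DegreeLE d c) (v : Fin (d + 2) → ℤ) (N : ℕ)
    (hv : (∀ i, 0 ≤ v i ∧ v i ≤ b + 1) ∧ v 0 = 0 ∧ v 1 = 1 ∧ (∀ i, nodeProd v i ≠ 0) ∧
      ∑ i, (if i = 0 ∨ i = 1 ∨ 0 ≤ nodeProd v 0 * nodeProd v i then 0
        else (nodeProd v 0).natAbs * N / (nodeProd v i).natAbs + 1) < N) :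
    BlockSensLE (zeta c) b := by
  obtain ⟨hvb, hv0, hv1, hne, hlt⟩ := hv
  intro κ _ x β hβ hs
  by_contra! hcard
  obtain ⟨q, hqd, hq0, hq1, hq⟩ := exists_block_polynomial hB hc x hβ hs (by omega)
  have hinj : Set.InjOn (fun i => (v i : ℝ)) (univ : Finset (Fin (d + 2))) := by
    intro i _ j _ hij
    by_contra hne'
    refine hne i (prod_eq_zero (mem_erase.mpr ⟨Ne.symm hne', mem_univ j⟩) ?_)
    have hij' : (v i : ℝ) = v j := hij
    rw [Int.cast_inj.mp hij', sub_self]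
  have hdeg : q.degree < #(univ : Finset (Fin (d + 2))) := by
    refine lt_of_le_of_lt degree_le_natDegree ?_
    rw [card_univ, Fintype.card_fin]
    exact_mod_cast (by omega : q.natDegree < d + 2)
  have hsum := Lagrange.coeff_eq_sum hinj hdeg
  rw [card_univ, Fintype.card_fin, coeff_eq_zero_of_natDegree_lt (by omega)] at hsum
  have hD : ∀ i, ∏ j ∈ univ.erase i, ((v i : ℝ) - v j) = (nodeProd v i : ℝ) := fun i => by
    rw [nodeProd]; push_cast; rfl
  simp_rw [hD] at hsum
  have hvq : ∀ i, 0 ≤ q.eval (v i : ℝ) ∧ q.eval (v i : ℝ) ≤ 1 := by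
    intro i
    obtain ⟨t, ht⟩ := Int.eq_ofNat_of_zero_le (hvb i).1
    have hle := (hvb i).2
    have := hq t (by omega)
    rw [ht]
    exact_mod_cast this
  set D : Fin (d + 2) → ℝ := fun i => (nodeProd v i : ℝ) with hDdef
  have hD0 : ∀ i, D i ≠ 0 := fun i => Int.cast_ne_zero.mpr (hne i)
  have hN : (0 : ℝ) ≤ N := Nat.cast_nonneg N
  -- compare with `N` times the divided difference, scaled so that the node `0` has weight `N`
  have hterm : ∀ i, -(((if i = 0 ∨ i = 1 ∨ 0 ≤ nodeProd v 0 * nodeProd v i then 0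
        else (nodeProd v 0).natAbs * N / (nodeProd v i).natAbs + 1 : ℕ)) : ℝ) +
        (if i = 0 then (N : ℝ) else 0) ≤ N * D 0 * (q.eval (v i : ℝ) / D i) := by
    intro i
    by_cases h0 : i = 0
    · subst h0
      rw [hv0, Int.cast_zero, hq0, if_pos rfl, if_pos (Or.inl rfl)]
      have h0 : (N : ℝ) * D 0 * (1 / D 0) = N := by
        rw [mul_assoc, mul_one_div_cancel (hD0 0), mul_one]
      rw [h0, Nat.cast_zero, neg_zero, zero_add]
    by_cases h1 : i = 1
    · subst h1
      rw [hv1, Int.cast_one, hq1, if_neg h0, if_pos (Or.inr (Or.inl rfl))]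
      simp
    rw [if_neg h0]
    by_cases hsign : 0 ≤ nodeProd v 0 * nodeProd v i
    · rw [if_pos (Or.inr (Or.inr hsign))]
      have h2 : (0 : ℝ) ≤ (nodeProd v 0 : ℝ) * (nodeProd v i : ℝ) := by exact_mod_cast hsign
      change 0 ≤ D 0 * D i at h2
      have h3 : N * D 0 * (q.eval (v i : ℝ) / D i) =
          N * (D 0 * D i) * q.eval (v i : ℝ) / (D i) ^ 2 := by
        have := hD0 i
        field_simp
      rw [h3]
      have := (hvq i).1
      simp only [Nat.cast_zero, neg_zero, add_zero]
      positivity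
    · rw [if_neg (not_or.mpr ⟨h0, not_or.mpr ⟨h1, hsign⟩⟩)]
      have h2 : (nodeProd v 0 : ℝ) * (nodeProd v i : ℝ) < 0 := by exact_mod_cast not_le.mp hsign
      change D 0 * D i < 0 at h2
      have hpos : 0 < (nodeProd v i).natAbs := Int.natAbs_pos.mpr (hne i)
      have h4 : ((nodeProd v 0).natAbs * N : ℝ) / (nodeProd v i).natAbs <
          ((nodeProd v 0).natAbs * N / (nodeProd v i).natAbs + 1 : ℕ) := by
        rw [div_lt_iff₀ (by exact_mod_cast hpos)]
        have := Nat.lt_div_mul_add (a := (nodeProd v 0).natAbs * N) hpos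
        have h5 : (nodeProd v 0).natAbs * N <
            ((nodeProd v 0).natAbs * N / (nodeProd v i).natAbs + 1) * (nodeProd v i).natAbs := by
          linarith
        exact_mod_cast h5
      have h5 : ((nodeProd v 0).natAbs * N : ℝ) / (nodeProd v i).natAbs = -(N * D 0 / D i) := by
        rw [Nat.cast_natAbs, Nat.cast_natAbs, Int.cast_abs, Int.cast_abs]
        change |D 0| * N / |D i| = _
        rw [mul_comm, mul_div_assoc, ← abs_div, abs_of_nonpos, mul_neg, mul_div_assoc]
        rw [div_nonpos_iff]
        rcases mul_neg_iff.mp h2 with h | h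
        · exact Or.inl ⟨h.1.le, h.2.le⟩
        · exact Or.inr ⟨h.1.le, h.2.le⟩
      have h6 : (0 : ℝ) ≤ -(N * D 0 / D i) := by rw [← h5]; positivity
      have h7 : N * D 0 * (q.eval (v i : ℝ) / D i) = -(-(N * D 0 / D i) * q.eval (v i : ℝ)) := by
        ring
      rw [h7, add_zero, neg_le_neg_iff]
      refine le_trans ?_ (h5 ▸ h4).le
      exact mul_le_of_le_one_right h6 (hvq i).2
  have htot := sum_le_sum fun i (_ : i ∈ univ) => hterm i
  rw [← mul_sum, ← hsum, mul_zero, sum_add_distrib, sum_neg_distrib, ← Nat.cast_sum,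
    sum_ite_eq' univ 0, if_pos (mem_univ _)] at htot
  have : ((N : ℕ) : ℝ) ≤ ((∑ i, (if i = 0 ∨ i = 1 ∨ 0 ≤ nodeProd v 0 * nodeProd v i then 0
        else (nodeProd v 0).natAbs * N / (nodeProd v i).natAbs + 1) : ℕ) : ℝ) := by linarith
  exact absurd (Nat.cast_le.mp this) (not_le.mpr hlt)

end Symmetrization

section QuadraticBound

open Polynomial

/-- `∑ 2 / (2 m² - 1)` over `2 ≤ m ≤ n` stays below `3 / 4`. -/
lemma sum_inv_squares_le (n : ℕ) :
    ∑ i ∈ range (n + 1), (if i = 0 then (0 : ℝ) else 2 / (2 * ((i : ℝ) + 1) ^ 2 - 1)) ≤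
      3 / 4 - (1 / ((n : ℝ) + 1) + 1 / ((n : ℝ) + 2)) / 2 := by
  induction n with
  | zero => norm_num
  | succ n ih =>
    rw [sum_range_succ, if_neg (Nat.succ_ne_zero n)]
    push_cast
    have hn : (0 : ℝ) ≤ n := Nat.cast_nonneg n
    have h1 : 2 / (2 * ((n : ℝ) + 1 + 1) ^ 2 - 1) ≤
        (1 / ((n : ℝ) + 1) - 1 / ((n : ℝ) + 3)) / 2 := by
      rw [div_sub_div _ _ (by positivity) (by positivity), div_div, div_le_div_iff₀]
      · nlinarith
      · nlinarith
      · positivity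
    have h2 : (n : ℝ) + 1 + 2 = n + 3 := by ring
    have h3 : (n : ℝ) + 1 + 1 = n + 2 := by ring
    rw [h3] at h1
    rw [h2, h3]
    linarith

/-- A bound for all degrees, from the nodes `0`, `1` and `2 m²` for `1 ≤ m ≤ d`. -/
lemma blockSensLE_two_mul_sq {ι : Type} [DecidableEq ι] [Fintype ι] {d : ℕ} {c : Finset ι → ℝ}
    (hB : IsBoolean c) (hc : DegreeLE d c) (hd : 0 < d) : BlockSensLE (zeta c) (2 * d ^ 2) := by
  intro κ _ x β hβ hs
  by_contra! hcard
  obtain ⟨q, hqd, hq0, hq1, hq⟩ := exists_block_polynomial hB hc x hβ hs (by omega)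
  -- write `q = (X - 1) * h`; then `h 0 = -1` and `h` is small and nonnegative at `2 m²`
  obtain ⟨h, rfl⟩ := dvd_iff_isRoot.mpr hq1
  have hne : h ≠ 0 := by rintro rfl; simp at hq0
  have hhd : h.natDegree + 1 ≤ d := by
    rw [natDegree_mul (X_sub_C_ne_zero 1) hne, natDegree_X_sub_C] at hqd
    omega
  have hh0 : h.eval 0 = -1 := by
    simp only [eval_mul, eval_sub, eval_X, eval_C] at hq0
    linarith
  have hhb : ∀ i < d, 0 ≤ h.eval (2 * ((i : ℝ) + 1) ^ 2) ∧
      h.eval (2 * ((i : ℝ) + 1) ^ 2) ≤ 1 / (2 * ((i : ℝ) + 1) ^ 2 - 1) := by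
    intro i hi
    have hle : 2 * (i + 1) ^ 2 ≤ Fintype.card κ := by
      have : (i + 1) ^ 2 ≤ d ^ 2 := Nat.pow_le_pow_left hi 2
      omega
    have := hq _ hle
    push_cast at this
    simp only [eval_mul, eval_sub, eval_X, eval_C] at this
    have hpos : (0 : ℝ) < 2 * ((i : ℝ) + 1) ^ 2 - 1 := by
      have : (0 : ℝ) ≤ i := Nat.cast_nonneg i
      nlinarith
    refine ⟨nonneg_of_mul_nonneg_right this.1 hpos, ?_⟩
    rw [le_div_iff₀ hpos, mul_comm]
    exact this.2
  -- the central difference of order `2 d` of `m ↦ h (2 m²)` vanishes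
  set r : ℝ[X] := h.comp (2 * (X - C (d : ℝ)) ^ 2) with hr
  have hrdeg : r.natDegree < 2 * d := by
    have h2 : (2 * (X - C (d : ℝ)) ^ 2).natDegree ≤ 2 := by
      refine natDegree_mul_le.trans ?_
      rw [show (2 : ℝ[X]) = C 2 from rfl, natDegree_C, zero_add]
      refine natDegree_pow_le.trans ?_
      rw [natDegree_X_sub_C]
    rw [hr, natDegree_comp]
    have := Nat.mul_le_mul_left h.natDegree h2
    omega
  have hre : ∀ m : ℝ, r.eval m = h.eval (2 * (m - d) ^ 2) := fun m => by
    simp [hr, eval_comp]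
  have hdiff := congrFun (Polynomial.fwdDiff_iter_eq_zero_of_degree_lt hrdeg) 0
  rw [fwdDiff_iter_eq_sum_shift] at hdiff
  simp only [zero_add, nsmul_eq_mul, mul_one, zsmul_eq_mul, Pi.zero_apply, Int.cast_mul,
    Int.cast_pow, Int.cast_neg, Int.cast_one, Int.cast_natCast, hre] at hdiff
  rw [show 2 * d + 1 = d + (d + 1) by ring, sum_range_add, sum_range_succ', ← sum_range_reflect,
    ← add_assoc, ← sum_add_distrib] at hdiff
  have hC : (0 : ℝ) < (2 * d).choose d := by exact_mod_cast Nat.choose_pos (by omega)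
  -- the terms `m = ±(i + 1)`; those with `m = ±1` have a favourable sign
  have hterm : ∀ i ∈ range d,
      (-1 : ℝ) ^ d * ((-1) ^ (2 * d - (d - 1 - i)) * ((2 * d).choose (d - 1 - i) : ℝ) *
          h.eval (2 * (((d - 1 - i : ℕ) : ℝ) - d) ^ 2) +
        (-1) ^ (2 * d - (d + (i + 1))) * ((2 * d).choose (d + (i + 1)) : ℝ) *
          h.eval (2 * (((d + (i + 1) : ℕ) : ℝ) - d) ^ 2)) ≤
      (2 * d).choose d *
        (if i = 0 then (0 : ℝ) else 2 / (2 * ((i : ℝ) + 1) ^ 2 - 1)) := by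
    intro i hi
    rw [mem_range] at hi
    obtain ⟨e, rfl⟩ : ∃ e, d = e + i + 1 := ⟨d - i - 1, by omega⟩
    have e1 : e + i + 1 - 1 - i = e := by omega
    have e2 : 2 * (e + i + 1) - e = (e + i + 1) + (i + 1) := by omega
    have e3 : 2 * (e + i + 1) - (e + i + 1 + (i + 1)) = e := by omega
    have e4 : (2 * (e + i + 1)).choose (e + i + 1 + (i + 1)) = (2 * (e + i + 1)).choose e := by
      rw [← Nat.choose_symm (by omega), e3]
    have e5 : (2 * ((e : ℝ) - (e + i + 1 : ℕ)) ^ 2) = 2 * ((i : ℝ) + 1) ^ 2 := by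
      push_cast; ring
    have e6 : (2 * (((e + i + 1 + (i + 1) : ℕ) : ℝ) - (e + i + 1 : ℕ)) ^ 2) =
        2 * ((i : ℝ) + 1) ^ 2 := by
      push_cast; ring
    rw [e1, e2, e3, e4, e5, e6]
    have s1 : (-1 : ℝ) ^ (e + i + 1) * (-1) ^ (e + i + 1 + (i + 1)) = (-1) ^ (i + 1) := by
      rw [pow_add (-1 : ℝ) (e + i + 1) (i + 1), ← mul_assoc, ← mul_pow]; norm_num
    have s2 : (-1 : ℝ) ^ (e + i + 1) * (-1) ^ e = (-1) ^ (i + 1) := by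
      rw [add_assoc, pow_add, mul_right_comm, ← mul_pow]; norm_num
    have hval := hhb i hi
    set V := h.eval (2 * ((i : ℝ) + 1) ^ 2)
    have hchoose : ((2 * (e + i + 1)).choose e : ℝ) ≤ (2 * (e + i + 1)).choose (e + i + 1) := by
      exact_mod_cast Nat.choose_le_centralBinom e (e + i + 1)
    have hc0 : (0 : ℝ) ≤ (2 * (e + i + 1)).choose e := Nat.cast_nonneg _
    have hlhs : (-1 : ℝ) ^ (e + i + 1) * ((-1) ^ (e + i + 1 + (i + 1)) *
        ((2 * (e + i + 1)).choose e : ℝ) * V + (-1) ^ e * ((2 * (e + i + 1)).choose e : ℝ) * V) =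
        (-1) ^ (i + 1) * (2 * ((2 * (e + i + 1)).choose e : ℝ) * V) := by
      linear_combination ((2 * (e + i + 1)).choose e : ℝ) * V * s1 +
        ((2 * (e + i + 1)).choose e : ℝ) * V * s2
    rw [hlhs]
    split_ifs with hi0
    · subst hi0
      have := mul_nonneg hc0 hval.1
      norm_num
      linarith
    · have hX : 0 ≤ 2 * ((2 * (e + i + 1)).choose e : ℝ) * V :=
        mul_nonneg (by positivity) hval.1
      have hsgn : (-1 : ℝ) ^ (i + 1) ≤ 1 := by
        rcases neg_one_pow_eq_or ℝ (i + 1) with h | h <;> rw [h]; norm_num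
      calc (-1 : ℝ) ^ (i + 1) * (2 * ((2 * (e + i + 1)).choose e : ℝ) * V)
          ≤ 2 * ((2 * (e + i + 1)).choose e : ℝ) * V := mul_le_of_le_one_left hX hsgn
        _ ≤ 2 * (2 * (e + i + 1)).choose (e + i + 1) * (1 / (2 * ((i : ℝ) + 1) ^ 2 - 1)) := by
            gcongr
            · exact hval.1
            · exact hval.2
        _ = _ := by ring
  -- the central term, in which `h` is evaluated at `0`
  have hlast : (-1 : ℝ) ^ d * ((-1) ^ (2 * d - (d + 0)) * ((2 * d).choose (d + 0) : ℝ) *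
      h.eval (2 * (((d + 0 : ℕ) : ℝ) - d) ^ 2)) = -((2 * d).choose d : ℝ) := by
    have s1 : (-1 : ℝ) ^ d * (-1) ^ (2 * d - (d + 0)) = 1 := by
      rw [show 2 * d - (d + 0) = d by omega, ← mul_pow]; norm_num
    rw [← mul_assoc, ← mul_assoc, s1]
    simp [hh0]
  have hzero := congrArg (fun y => (-1 : ℝ) ^ d * y) hdiff
  simp only [mul_zero] at hzero
  rw [mul_add, mul_sum, hlast] at hzero
  have hsum := sum_le_sum hterm
  obtain ⟨m, rfl⟩ : ∃ m, d = m + 1 := ⟨d - 1, by omega⟩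
  have hlt : ∑ i ∈ range (m + 1),
      (if i = 0 then (0 : ℝ) else 2 / (2 * ((i : ℝ) + 1) ^ 2 - 1)) < 1 := by
    refine (sum_inv_squares_le m).trans_lt ?_
    have : (0 : ℝ) ≤ (1 / ((m : ℝ) + 1) + 1 / ((m : ℝ) + 2)) / 2 := by positivity
    linarith
  have := mul_lt_mul_of_pos_left hlt hC
  rw [mul_sum] at this
  linarith

end QuadraticBound

/-! ### The recursion on the degree -/

/-- Boolean functions of degree at most `d` satisfy `weight ≤ a + d / 2 ^ d * bs`. -/
def AffineBound (d : ℕ) (a : ℝ) : Prop :=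
  ∀ (n : ℕ) (c : Finset (Fin n) → ℝ), IsBoolean c → DegreeLE d c →
    ∀ b, BlockSensLE (zeta c) b → weight c ≤ a + (d : ℝ) / 2 ^ d * b

/-- Functions of degree `0` have no weight, so any slope may be used there; `1 / 2` is the slope in
degree `1`. -/
lemma affineBound_one : AffineBound 1 0 := by
  have h0 : ∀ (n : ℕ) (c : Finset (Fin n) → ℝ), IsBoolean c → DegreeLE 0 c → weight c ≤ 0 :=
    fun n c hB hc => by simpa using weight_le_half_degree hB hc
  intro n c hB hc b hb
  refine weight_le_succ (d := 0) (a := 0) (s := 1 / 2) (u := 0) (θ := 1) (by norm_num) le_rfl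
    (by norm_num) (by norm_num) h0 (fun m c' hB' hc' k _ => ?_) n c hB hc b hb
  have := h0 m c' hB' hc'
  have hk : (0 : ℝ) ≤ 1 / 2 * k := by positivity
  linarith

lemma slope_ratio_le {d : ℕ} (hd : 1 ≤ d) : ((d : ℝ) + 1) / (2 * d) ≤ 1 := by
  have : (1 : ℝ) ≤ d := by exact_mod_cast hd
  rw [div_le_one (by positivity)]
  linarith

lemma slope_ratio_mul {d : ℕ} (hd : 1 ≤ d) :
    ((d : ℝ) + 1) / (2 * d) * ((d : ℝ) / 2 ^ d) = (d + 1 : ℕ) / (2 : ℝ) ^ (d + 1) := by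
  have : (d : ℝ) ≠ 0 := by positivity
  push_cast
  field_simp
  ring

/-- The recursion step that uses `weight ≤ d / 2` in degree `d`. -/
lemma AffineBound.succ_of_degree {d : ℕ} {a a' : ℝ} (h : AffineBound d a) (hd : 1 ≤ d)
    (ha' : (1 - ((d : ℝ) + 1) / (2 * d)) * (d / 2) + ((d : ℝ) + 1) / (2 * d) * a ≤ a') :
    AffineBound (d + 1) a' :=
  weight_le_succ (by positivity) (slope_ratio_le hd) (slope_ratio_mul hd) ha'
    (fun _ _ hB hc => weight_le_half_degree hB hc) h

/-- The recursion step that uses a bound for the block sensitivity in degree `d`. -/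
lemma AffineBound.succ_of_blockSens {d b : ℕ} {a a' : ℝ} (h : AffineBound d a) (hd : 1 ≤ d)
    (hb : ∀ (n : ℕ) (c : Finset (Fin n) → ℝ), IsBoolean c → DegreeLE d c → BlockSensLE (zeta c) b)
    (ha' : a + ((d : ℝ) / 2 ^ d - ((d + 1 : ℕ) : ℝ) / 2 ^ (d + 1)) * b ≤ a') :
    AffineBound (d + 1) a' := by
  refine weight_le_succ (u := a + (d : ℝ) / 2 ^ d * b) (by positivity) (slope_ratio_le hd)
    (slope_ratio_mul hd) ?_ (fun n c hB hc => h n c hB hc b (hb n c hB hc)) h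
  have := slope_ratio_mul hd
  linear_combination ha' - b * this

/-- The first seven steps use `weight ≤ d / 2` and exact constants. In the later steps the constants
are rounded up to five decimals; the last node is one more than the bound `b` that it proves. -/
lemma affineBound_twenty : AffineBound 20 4.3915 := by
  have h2 : AffineBound 2 0 := affineBound_one.succ_of_degree (by norm_num) (by norm_num)
  have h3 : AffineBound 3 (1 / 4) := h2.succ_of_degree (by norm_num) (by norm_num)
  have h4 : AffineBound 4 (2 / 3) := h3.succ_of_degree (by norm_num) (by norm_num)
  have h5 : AffineBound 5 (7 / 6) := h4.succ_of_degree (by norm_num) (by norm_num)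
  have h6 : AffineBound 6 (17 / 10) := h5.succ_of_degree (by norm_num) (by norm_num)
  have h7 : AffineBound 7 (269 / 120) := h6.succ_of_degree (by norm_num) (by norm_num)
  have h8 : AffineBound 8 (292 / 105) := h7.succ_of_degree (by norm_num) (by norm_num)
  have h9 : AffineBound 9 3.30049 :=
    h8.succ_of_blockSens (by norm_num) (b := 38) (fun _ _ hB hc => blockSensLE_of_nodes hB hc
      ![0, 1, 2, 6, 12, 19, 27, 33, 37, 39]
      (10 ^ 6) (by decide +kernel)) (by norm_num)
  have h10 : AffineBound 10 3.66768 :=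
    h9.succ_of_blockSens (by norm_num) (b := 47) (fun _ _ hB hc => blockSensLE_of_nodes hB hc
      ![0, 1, 2, 6, 12, 20, 28, 36, 42, 46, 48]
      (10 ^ 6) (by decide +kernel)) (by norm_num)
  have h11 : AffineBound 11 3.92257 :=
    h10.succ_of_blockSens (by norm_num) (b := 58) (fun _ _ hB hc => blockSensLE_of_nodes hB hc
      ![0, 1, 2, 6, 12, 20, 29, 39, 47, 53, 57, 59]
      (10 ^ 6) (by decide +kernel)) (by norm_num)
  have h12 : AffineBound 12 4.09591 :=
    h11.succ_of_blockSens (by norm_num) (b := 71) (fun _ _ hB hc => blockSensLE_of_nodes hB hc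
      ![0, 1, 2, 6, 12, 21, 31, 41, 51, 60, 66, 70, 72]
      (10 ^ 6) (by decide +kernel)) (by norm_num)
  have h13 : AffineBound 13 4.20871 :=
    h12.succ_of_blockSens (by norm_num) (b := 84) (fun _ _ hB hc => blockSensLE_of_nodes hB hc
      ![0, 1, 2, 6, 13, 21, 32, 42, 53, 64, 72, 79, 83, 85]
      (10 ^ 6) (by decide +kernel)) (by norm_num)
  have h14 : AffineBound 14 4.28122 :=
    h13.succ_of_blockSens (by norm_num) (b := 99) (fun _ _ hB hc => blockSensLE_of_nodes hB hc
      ![0, 1, 2, 6, 13, 22, 32, 44, 56, 68, 78, 87, 94, 98, 100]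
      (10 ^ 6) (by decide +kernel)) (by norm_num)
  have h15 : AffineBound 15 4.32645 :=
    h14.succ_of_blockSens (by norm_num) (b := 114) (fun _ _ hB hc => blockSensLE_of_nodes hB hc
      ![0, 1, 2, 6, 13, 22, 33, 45, 57, 70, 82, 93, 102, 109, 113, 115]
      (10 ^ 6) (by decide +kernel)) (by norm_num)
  have h16 : AffineBound 16 4.35444 :=
    h15.succ_of_blockSens (by norm_num) (b := 131) (fun _ _ hB hc => blockSensLE_of_nodes hB hc
      ![0, 1, 2, 6, 13, 22, 33, 46, 59, 73, 86, 99, 110, 119, 126, 130, 132]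
      (10 ^ 6) (by decide +kernel)) (by norm_num)
  have h17 : AffineBound 17 4.37150 :=
    h16.succ_of_blockSens (by norm_num) (b := 149) (fun _ _ hB hc => blockSensLE_of_nodes hB hc
      ![0, 1, 2, 6, 13, 22, 33, 46, 60, 75, 90, 104, 117, 128, 137, 144, 148, 150]
      (10 ^ 6) (by decide +kernel)) (by norm_num)
  have h18 : AffineBound 18 4.38176 :=
    h17.succ_of_blockSens (by norm_num) (b := 168) (fun _ _ hB hc => blockSensLE_of_nodes hB hc
      ![0, 1, 2, 6, 13, 22, 34, 47, 61, 77, 92, 108, 122, 135, 147, 156, 163, 167, 169]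
      (10 ^ 6) (by decide +kernel)) (by norm_num)
  have h19 : AffineBound 19 4.38789 :=
    h18.succ_of_blockSens (by norm_num) (b := 189) (fun _ _ hB hc => blockSensLE_of_nodes hB hc
      ![0, 1, 2, 6, 13, 22, 34, 48, 63, 79, 95, 111, 127, 142, 156, 168, 177, 184,
        188, 190]
      (10 ^ 6) (by decide +kernel)) (by norm_num)
  have h20 : AffineBound 20 4.3915 :=
    h19.succ_of_blockSens (by norm_num) (b := 210) (fun _ _ hB hc => blockSensLE_of_nodes hB hc
      ![0, 1, 2, 6, 13, 22, 34, 48, 63, 80, 97, 114, 131, 148, 163, 177, 189, 198,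
        205, 209, 211]
      (10 ^ 6) (by decide +kernel)) (by norm_num)
  exact h20

/-- The constants stay below `4.4158` by a margin that accounts for the block sensitivity at every
later step. -/
lemma affineBound_of_twenty_le {d : ℕ} (hd : 20 ≤ d) :
    AffineBound d (4.4158 - (2 * d ^ 3 + 4 * d ^ 2 + 14 * d + 20 : ℝ) / 2 ^ d) := by
  induction d, hd using Nat.le_induction with
  | base =>
    intro n c hB hc b hb
    refine (affineBound_twenty n c hB hc b hb).trans ?_
    gcongr
    norm_num
  | succ d hd ih =>
    refine ih.succ_of_blockSens (b := 2 * d ^ 2) (by omega)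
      (fun _ _ hB hc => blockSensLE_two_mul_sq hB hc (by omega)) (le_of_eq ?_)
    push_cast
    field_simp
    ring

theorem weight_le {n : ℕ} {c : Finset (Fin n) → ℝ} (hB : IsBoolean c) : weight c ≤ 4.4158 := by
  -- every function of `n` variables has degree at most `n`
  set d := max n 20 with hd
  have hc : DegreeLE d c := fun S _ => (card_le_univ S).trans (by simp [hd])
  have hd20 : 20 ≤ d := le_max_right _ _
  refine (affineBound_of_twenty_le hd20 n c hB hc _
    (blockSensLE_two_mul_sq hB hc (by omega))).trans ?_
  have h : (2 * d ^ 3 + 4 * d ^ 2 + 14 * d + 20 : ℝ) / 2 ^ d - (d : ℝ) / 2 ^ d * (2 * d ^ 2 : ℕ) =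
      (4 * d ^ 2 + 14 * d + 20 : ℝ) / 2 ^ d := by
    push_cast
    field_simp
    ring
  have h' : (0 : ℝ) ≤ (4 * d ^ 2 + 14 * d + 20 : ℝ) / 2 ^ d := by positivity
  linarith

/-! ### The polynomial of a Boolean function -/

/-- The exponent vector of the monomial `∏ i ∈ S, x i`. -/
noncomputable def setExponent {n : ℕ} (S : Finset (Fin n)) : Fin n →₀ ℕ :=
  Finsupp.indicator S fun _ _ => 1

lemma setExponent_apply {n : ℕ} (S : Finset (Fin n)) (i : Fin n) :
    setExponent S i = if i ∈ S then 1 else 0 := by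
  simp [setExponent, Finsupp.indicator_apply]

lemma support_setExponent {n : ℕ} (S : Finset (Fin n)) : (setExponent S).support = S := by
  ext i
  simp [setExponent_apply]

lemma degree_setExponent {n : ℕ} (S : Finset (Fin n)) : (setExponent S).degree = #S := by
  rw [Finsupp.degree_apply, support_setExponent]
  simp [setExponent_apply]

lemma setExponent_injective {n : ℕ} : Function.Injective (setExponent (n := n)) := fun S T h => by
  rw [← support_setExponent S, h, support_setExponent]

/-- The coefficients of the multilinear polynomial of `f`, indexed by sets of variables. -/
noncomputable def boolCoeff {n : ℕ} (f : (Fin n → Bool) → Bool) (S : Finset (Fin n)) : ℝ :=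
  (boolPoly f).coeff (setExponent S)

lemma setExponent_support {n : ℕ} {f : (Fin n → Bool) → Bool} {m : Fin n →₀ ℕ}
    (hm : m ∈ (boolPoly f).support) : setExponent m.support = m := by
  ext i
  have h := (MvPolynomial.mem_restrictDegree _ _ _).mp (boolPoly_multilinear f) m hm i
  rw [setExponent_apply]
  split_ifs with hi
  · have := Finsupp.mem_support_iff.mp hi
    omega
  · exact (Finsupp.notMem_support_iff.mp hi).symm

lemma zeta_boolCoeff {n : ℕ} (f : (Fin n → Bool) → Bool) (T : Finset (Fin n)) :
    zeta (boolCoeff f) T = if f (fun i => decide (i ∈ T)) = true then 1 else 0 := by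
  rw [← eval_boolPoly, MvPolynomial.eval_eq']
  have hprod : ∀ S : Finset (Fin n),
      ∏ i, (if decide (i ∈ T) = true then (1 : ℝ) else 0) ^ setExponent S i =
        if S ⊆ T then 1 else 0 := by
    intro S
    split_ifs with h
    · refine prod_eq_one fun i _ => ?_
      rw [setExponent_apply]
      by_cases hi : i ∈ S
      · simp [h hi]
      · simp [hi]
    · obtain ⟨i, hi, hiT⟩ := not_subset.mp h
      refine prod_eq_zero (mem_univ i) ?_
      simp [setExponent_apply, hi, hiT]
  have hsub : (boolPoly f).support ⊆ univ.image setExponent := fun m hm =>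
    mem_image.mpr ⟨m.support, mem_univ _, setExponent_support hm⟩
  rw [sum_subset hsub fun m _ hm => by rw [MvPolynomial.notMem_support_iff.mp hm, zero_mul],
    sum_image fun S _ T _ h => setExponent_injective h]
  simp_rw [hprod, mul_ite, mul_one, mul_zero]
  rw [← sum_filter, zeta]
  exact sum_congr (by ext S; simp) fun _ _ => rfl

lemma isBoolean_boolCoeff {n : ℕ} (f : (Fin n → Bool) → Bool) : IsBoolean (boolCoeff f) :=
  fun T => by
    rw [zeta_boolCoeff]
    split_ifs
    · exact Or.inr rfl
    · exact Or.inl rfl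

lemma juntaWeight_le_weight {n : ℕ} (f : (Fin n → Bool) → Bool) :
    juntaWeight f ≤ weight (boolCoeff f) := by
  refine le_trans (sum_le_sum fun i hi => ?_)
    (sum_le_univ_sum_of_nonneg fun i => varWeight_nonneg (boolCoeff f) i)
  obtain ⟨m, hm, him⟩ := (MvPolynomial.mem_vars_iff_mem_support i).mp hi
  refine le_varWeight ⟨m.support, him, ?_⟩ fun S hiS hS => ?_
  · rw [boolCoeff, setExponent_support hm]
    exact MvPolynomial.mem_support_iff.mp hm
  · rw [← degree_setExponent S]
    refine Finset.le_sup (f := Finsupp.degree) (mem_filter.mpr ⟨?_, ?_⟩)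
    · exact MvPolynomial.mem_support_iff.mpr hS
    · rwa [support_setExponent]

lemma degreeAt_le_boolDegree {n : ℕ} (f : (Fin n → Bool) → Bool) (i : Fin n) :
    degreeAt f i ≤ boolDegree f :=
  Finset.sup_le fun _ hm => MvPolynomial.le_totalDegree (mem_filter.mp hm).1

end BooleanJunta

theorem theorem3 :
    (∀ (n d : ℕ) (f : (Fin n → Bool) → Bool), boolDegree f = d →
      ((relevantVars f).card : ℝ) ≤ 4.416 * (2 : ℝ) ^ d) ∧
    (∀ (n : ℕ) (f : (Fin n → Bool) → Bool), juntaWeight f ≤ 4.4158) := by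
  have hW : ∀ (n : ℕ) (f : (Fin n → Bool) → Bool), juntaWeight f ≤ 4.4158 := fun n f =>
    (BooleanJunta.juntaWeight_le_weight f).trans
      (BooleanJunta.weight_le (BooleanJunta.isBoolean_boolCoeff f))
  refine ⟨fun n d f hd => ?_, hW⟩
  have h1 : ((relevantVars f).card : ℝ) * ((2 : ℝ) ^ d)⁻¹ ≤ juntaWeight f := by
    rw [← nsmul_eq_mul]
    refine Finset.card_nsmul_le_sum _ _ _ fun i _ => ?_
    gcongr
    · norm_num
    · exact hd ▸ BooleanJunta.degreeAt_le_boolDegree f i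
  have h2 : ((relevantVars f).card : ℝ) * ((2 : ℝ) ^ d)⁻¹ ≤ 4.416 :=
    (h1.trans (hW n f)).trans (by norm_num)
  rwa [← div_eq_mul_inv, div_le_iff₀ (by positivity)] at h2
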